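/- Let $\mathbb F$ be an algebraically closed field of characteristic $0$, let $d\ge 0$ be an integer, and let $V$ be a vector space over $\mathbb F$ of dimension $d+1$. A $(d+1)\times(d+1)$ matrix $B$ (rows and columns indexed by $0,\dots,d$) is called lower bidiagonal if every nonzero entry is on the diagonal or the subdiagonal and every entry on the subdiagonal is nonzero; it is called upper bidiagonal if its transpose is lower bidiagonal. A matrix $B$ represents $A\in{\rm End}(V)$ with respect to a basis $\{v_i\}_{i=0}^d$ if $Av_j=\sum_i B_{ij}v_i$ for all $j$. For $0\ne b\in\mathbb F$, a sequence $\{\alpha_i\}_{i=0}^d$ of scalars in $\mathbb F$ is called $b$-recurrent if $\alpha_{i-1}\neq\alpha_i$ for $1\le i\le d$ and $(\alpha_i-\alpha_{i+1})/(\alpha_{i-1}-\alpha_i)=b$ for $1\le i\le d-1$. For nonzero $q\in\mathbb F$ with $q^2\ne1$, let $U_q(\mathfrak{sl}_2)$ be the $\mathbb F$-algebra with generators $x,y^{\pm1},z$ and relations $yy^{-1}=y^{-1}y=1$, $$\frac{qxy-q^{-1}yx}{q-q^{-1}}=1,\qquad \frac{qyz-q^{-1}zy}{q-q^{-1}}=1,\qquad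 \frac{qzx-q^{-1}xz}{q-q^{-1}}=1.$$ In the Lie algebra $\mathfrak{sl}_2$ over $\mathbb F$, with standard basis $e,f,h$ ($[h,e]=2e$, $[h,f]=-2f$, $[e,f]=h$), let $x=2e-h$, $y=-2f-h$, $z=h$ be the equitable basis, which satisfies $[x,y]=2x+2y$, $[y,z]=2y+2z$, $[z,x]=2z+2x$. Let $X,Y,Z\in{\rm End}(V)$, and assume that there are three bases of $V$ such that the matrices representing $X$, $Y$, $Z$ are respectively: diagonal, lower bidiagonal, upper bidiagonal with respect to basis 1; upper bidiagonal, diagonal, lower bidiagonal with respect to basis 2; lower bidiagonal, upper bidiagonal, diagonal with respect to basis 3. Then there exists $0\neq b\in\mathbb F$ such that the sequences of diagonal entries (top left to bottom right) of the three diagonal matrices, namely those representing $X$ with respect to basis 1, $Y$ with respect to basis 2 and $Z$ with respect to basis 3, are all $b$-recurrent. Moreover, for every such $b$ the following hold. (i) If $b\ne1$, then for every $q\in\mathbb F$ with $b=q^{-2}$ there exists an irreducible $U_q(\mathfrak{sl}_2)$-module structure on $V$ (compatible with the $\mathbb F$-vector space structure) such that on $V$ $$x\in\mathbb FX+\mathbb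 FI,\qquad y\in\mathbb FY+\mathbb FI,\qquad z\in\mathbb FZ+\mathbb FI.$$ (ii) If $b=1$, then there exists an irreducible $\mathfrak{sl}_2$-module structure on $V$ such that on $V$ the same three memberships hold for the equitable basis $x,y,z$ of $\mathfrak{sl}_2$. -/

import Mathlib

/-- A square matrix is lower bidiagonal when every nonzero entry is on the diagonal or the
subdiagonal, and every entry on the subdiagonal is nonzero. -/
def IsLowerBidiagonal {F : Type*} [Zero F] {n : ℕ} (B : Matrix (Fin n) (Fin n) F) : Prop :=
  (∀ i j : Fin n, B i j ≠ 0 → i = j ∨ (i : ℕ) = (j : ℕ) + 1) ∧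
  ∀ i j : Fin n, (i : ℕ) = (j : ℕ) + 1 → B i j ≠ 0

/-- A square matrix is upper bidiagonal when its transpose is lower bidiagonal. -/
def IsUpperBidiagonal {F : Type*} [Zero F] {n : ℕ} (B : Matrix (Fin n) (Fin n) F) : Prop :=
  IsLowerBidiagonal B.transpose

/-- A finite sequence of scalars is `b`-recurrent when consecutive terms are distinct and
each ratio of consecutive differences equals `b`. -/
def IsRecurrent {F : Type*} [Field F] {n : ℕ} (b : F) (α : Fin n → F) : Prop :=
  (∀ i j : Fin n, (j : ℕ) = (i : ℕ) + 1 → α i ≠ α j) ∧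
  ∀ i j k : Fin n, (j : ℕ) = (i : ℕ) + 1 → (k : ℕ) = (j : ℕ) + 1 →
    (α j - α k) / (α i - α j) = b

/-! ### The algebra `U_q(sl₂)` in its equitable presentation -/

/-- The generators `x`, `y`, `y⁻¹`, `z`. -/
inductive EquitableGen : Type
  | x
  | y
  | yInv
  | z

/-- The defining relations of the equitable presentation. -/
inductive EquitableRel (F : Type*) [Field F] (q : F) :
    FreeAlgebra F EquitableGen → FreeAlgebra F EquitableGen → Prop
  | y_mul_yInv : EquitableRel F q
      (FreeAlgebra.ι F EquitableGen.y * FreeAlgebra.ι F EquitableGen.yInv) 1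
  | yInv_mul_y : EquitableRel F q
      (FreeAlgebra.ι F EquitableGen.yInv * FreeAlgebra.ι F EquitableGen.y) 1
  | xy : EquitableRel F q
      ((q - q⁻¹)⁻¹ • (q • (FreeAlgebra.ι F EquitableGen.x * FreeAlgebra.ι F EquitableGen.y) -
        q⁻¹ • (FreeAlgebra.ι F EquitableGen.y * FreeAlgebra.ι F EquitableGen.x))) 1
  | yz : EquitableRel F q
      ((q - q⁻¹)⁻¹ • (q • (FreeAlgebra.ι F EquitableGen.y * FreeAlgebra.ι F EquitableGen.z) -
        q⁻¹ • (FreeAlgebra.ι F EquitableGen.z * FreeAlgebra.ι F EquitableGen.y))) 1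
  | zx : EquitableRel F q
      ((q - q⁻¹)⁻¹ • (q • (FreeAlgebra.ι F EquitableGen.z * FreeAlgebra.ι F EquitableGen.x) -
        q⁻¹ • (FreeAlgebra.ι F EquitableGen.x * FreeAlgebra.ι F EquitableGen.z))) 1

/-- The `F`-algebra `U_q(sl₂)`, for `q` nonzero with `q ^ 2 ≠ 1`. -/
def Uqsl2 (F : Type*) [Field F] (q : F) : Type _ := RingQuot (EquitableRel F q)

noncomputable instance Uqsl2.instRing (F : Type*) [Field F] (q : F) : Ring (Uqsl2 F q) :=
  inferInstanceAs (Ring (RingQuot (EquitableRel F q)))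

noncomputable instance Uqsl2.instAlgebra (F : Type*) [Field F] (q : F) :
    Algebra F (Uqsl2 F q) :=
  inferInstanceAs (Algebra F (RingQuot (EquitableRel F q)))

/-- The image of a generator in `U_q(sl₂)`. -/
noncomputable def Uqsl2.gen (F : Type*) [Field F] (q : F) (g : EquitableGen) : Uqsl2 F q :=
  RingQuot.mkAlgHom F (EquitableRel F q) (FreeAlgebra.ι F g)

/-- The operator by which `u : U_q(sl₂)` acts on the module `V`. -/
noncomputable def Uqsl2.action {F : Type*} [Field F] {q : F} (V : Type*) [AddCommGroup V]
    [Module F V] [Module (Uqsl2 F q) V] [IsScalarTower F (Uqsl2 F q) V] (u : Uqsl2 F q) :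
    Module.End F V :=
  Algebra.lsmul F F V u

/-! ### The equitable basis of `sl₂`

In terms of the usual basis `e, f, h` it is `x = 2e - h`, `y = -2f - h`, `z = h`. -/

/-- The element `x = 2e - h`. -/
def sl2X (F : Type*) [Field F] : LieAlgebra.SpecialLinear.sl (Fin 2) F :=
  ⟨!![-1, 2; 0, 1], by
    simp [LieAlgebra.SpecialLinear.sl, LinearMap.mem_ker, Matrix.trace_fin_two]⟩

/-- The element `y = -2f - h`. -/
def sl2Y (F : Type*) [Field F] : LieAlgebra.SpecialLinear.sl (Fin 2) F :=
  ⟨!![-1, 0; -2, 1], by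
    simp [LieAlgebra.SpecialLinear.sl, LinearMap.mem_ker, Matrix.trace_fin_two]⟩

/-- The element `z = h`. -/
def sl2Z (F : Type*) [Field F] : LieAlgebra.SpecialLinear.sl (Fin 2) F :=
  ⟨!![1, 0; 0, -1], by
    simp [LieAlgebra.SpecialLinear.sl, LinearMap.mem_ker, Matrix.trace_fin_two]⟩

theorem sl2_lie_XY (F : Type*) [Field F] :
    ⁅sl2X F, sl2Y F⁆ = (2 : F) • sl2X F + (2 : F) • sl2Y F := by
  apply Subtype.ext
  ext i j
  fin_cases i <;> fin_cases j <;>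
    simp [sl2X, sl2Y, Ring.lie_def] <;> ring

theorem sl2_lie_YZ (F : Type*) [Field F] :
    ⁅sl2Y F, sl2Z F⁆ = (2 : F) • sl2Y F + (2 : F) • sl2Z F := by
  apply Subtype.ext
  ext i j
  fin_cases i <;> fin_cases j <;>
    simp [sl2Y, sl2Z, Ring.lie_def] <;> ring

theorem sl2_lie_ZX (F : Type*) [Field F] :
    ⁅sl2Z F, sl2X F⁆ = (2 : F) • sl2Z F + (2 : F) • sl2X F := by
  apply Subtype.ext
  ext i j
  fin_cases i <;> fin_cases j <;>
    simp [sl2X, sl2Z, Ring.lie_def] <;> ring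

/-!
The argument first treats two operators `S`, `T` such that each is diagonal in one basis and
bidiagonal in the other. After reversing one basis, both bidiagonal matrices are upper
bidiagonal, and the coordinates `c k j` of the eigenvectors of `S` in the eigenbasis of `T` satisfy
`(A k - x j) c k j = s j c k (j+1)` and `(β j - y k) c k j = φ k c (k-1) j`, where `A`, `β` are the
eigenvalues and `x`, `y` the diagonals of the bidiagonal matrices. Since the eigenvalues are
distinct (`diag_injective_of_isUpperBidiagonal`), these equations force `c k` to be supported
exactly on `j ≤ k` (`IsBidiagonalTransition.ne_zero_iff`), hence `x = A` and `y = β`. Going around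
a square of four coefficients in both ways then gives
`(β j - β k) (A (k-1) - A j) = (A k - A j) (β (j+1) - β k)` for `j < k`
(`IsBidiagonalTransition.square`). The case `k = j + 2` says that the ratios of consecutive
differences of `A` are inverse to those of `β`, and adding the case `k = j + 3` shows that the
ratio is constant. So both eigenvalue sequences are recurrent with a common parameter `b`
(`bidiagonal_pair`), and overlapping pairs in the triple share that parameter.

Conversely, recurrence gives the relations at once. If `X` has eigenvalues `a + a' b ^ i` and `Y` is
lower bidiagonal with diagonal `c + c' b ^ (d - i)`, then
`(X - a) (Y - c) - b (Y - c) (X - a)` is scalar, because its subdiagonal entries cancel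
(`qCommutator_eq`); for `b = 1` the eigenvalues are arithmetic progressions and `commutator_eq`
plays the same role. Scaling `X - a`, `Y - c` and `Z - e` yields the equitable relations.
An invariant subspace contains an eigenvector of `X` by Lagrange interpolation, and `Y` and `Z`
move it along the whole basis (`eq_bot_or_eq_top_of_invariant`), so the module is irreducible.
-/

/-! ### Bidiagonal matrices and bases -/

theorem toMatrix_reindex_revPerm {F V : Type*} [Field F] [AddCommGroup V] [Module F V] {n : ℕ}
    (v : Module.Basis (Fin n) F V) (T : Module.End F V) (i j : Fin n) :
    LinearMap.toMatrix (v.reindex Fin.revPerm) (v.reindex Fin.revPerm) T i j =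
      LinearMap.toMatrix v v T i.rev j.rev := by
  simp [LinearMap.toMatrix_apply]

theorem IsLowerBidiagonal.reindex_revPerm {F V : Type*} [Field F] [AddCommGroup V] [Module F V]
    {n : ℕ} {v : Module.Basis (Fin n) F V} {T : Module.End F V}
    (h : IsLowerBidiagonal (LinearMap.toMatrix v v T)) :
    IsUpperBidiagonal
      (LinearMap.toMatrix (v.reindex Fin.revPerm) (v.reindex Fin.revPerm) T) := by
  refine ⟨fun i j hij => ?_, fun i j hij => ?_⟩
  · rw [Matrix.transpose_apply, toMatrix_reindex_revPerm] at hij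
    rcases h.1 _ _ hij with h1 | h1
    · left
      exact (Fin.rev_injective h1).symm
    · right
      simp only [Fin.val_rev] at h1
      omega
  · rw [Matrix.transpose_apply, toMatrix_reindex_revPerm]
    apply h.2
    simp only [Fin.val_rev]
    omega

theorem IsDiag.reindex_revPerm {F V : Type*} [Field F] [AddCommGroup V] [Module F V]
    {n : ℕ} {v : Module.Basis (Fin n) F V} {T : Module.End F V}
    (h : (LinearMap.toMatrix v v T).IsDiag) :
    (LinearMap.toMatrix (v.reindex Fin.revPerm) (v.reindex Fin.revPerm) T).IsDiag := by
  intro i j hij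
  rw [toMatrix_reindex_revPerm]
  exact h fun h' => hij (Fin.rev_injective h')

theorem apply_basis_of_isDiag {F V : Type*} [Field F] [AddCommGroup V] [Module F V] {n : ℕ}
    {v : Module.Basis (Fin n) F V} {T : Module.End F V}
    (h : (LinearMap.toMatrix v v T).IsDiag) (i : Fin n) :
    T (v i) = LinearMap.toMatrix v v T i i • v i := by
  rw [← v.sum_repr (T (v i)), Finset.sum_eq_single i]
  · rw [LinearMap.toMatrix_apply]
  · intro j _ hj
    rw [← LinearMap.toMatrix_apply v v T j i, h hj, zero_smul]
  · simp

theorem repr_apply_of_isDiag {F V : Type*} [Field F] [AddCommGroup V] [Module F V] {n : ℕ}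
    {v : Module.Basis (Fin n) F V} {T : Module.End F V}
    (h : (LinearMap.toMatrix v v T).IsDiag) (w : V) (i : Fin n) :
    v.repr (T w) i = LinearMap.toMatrix v v T i i * v.repr w i := by
  rw [← LinearMap.toMatrix_mulVec_repr v v T w, Matrix.mulVec, dotProduct,
    Finset.sum_eq_single i]
  · intro j _ hj
    rw [h hj.symm, zero_mul]
  · simp

theorem repr_apply_of_isUpperBidiagonal {F V : Type*} [Field F] [AddCommGroup V] [Module F V]
    {n : ℕ} {v : Module.Basis (Fin n) F V} {T : Module.End F V}
    (h : IsUpperBidiagonal (LinearMap.toMatrix v v T)) (w : V) {i j : Fin n}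
    (hij : (j : ℕ) = i + 1) :
    v.repr (T w) i = LinearMap.toMatrix v v T i i * v.repr w i +
      LinearMap.toMatrix v v T i j * v.repr w j := by
  rw [← LinearMap.toMatrix_mulVec_repr v v T w, Matrix.mulVec, dotProduct,
    Finset.sum_eq_add i j (by intro e; subst e; omega)]
  · rintro k - ⟨hk, hk'⟩
    by_cases hz : LinearMap.toMatrix v v T i k = 0
    · rw [hz, zero_mul]
    · rcases h.1 k i hz with h1 | h1
      · exact absurd h1 hk
      · exact absurd (Fin.ext (by omega)) hk'
  · simp
  · simp

theorem repr_apply_last_of_isUpperBidiagonal {F V : Type*} [Field F] [AddCommGroup V]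
    [Module F V] {n : ℕ} {v : Module.Basis (Fin n) F V} {T : Module.End F V}
    (h : IsUpperBidiagonal (LinearMap.toMatrix v v T)) (w : V) {i : Fin n}
    (hi : (i : ℕ) + 1 = n) :
    v.repr (T w) i = LinearMap.toMatrix v v T i i * v.repr w i := by
  rw [← LinearMap.toMatrix_mulVec_repr v v T w, Matrix.mulVec, dotProduct,
    Finset.sum_eq_single i]
  · rintro k - hk
    by_cases hz : LinearMap.toMatrix v v T i k = 0
    · rw [hz, zero_mul]
    · rcases h.1 k i hz with h1 | h1
      · exact absurd h1 hk
      · omega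
  · simp

theorem apply_basis_of_isUpperBidiagonal {F V : Type*} [Field F] [AddCommGroup V] [Module F V]
    {n : ℕ} {v : Module.Basis (Fin n) F V} {T : Module.End F V}
    (h : IsUpperBidiagonal (LinearMap.toMatrix v v T)) {i j : Fin n}
    (hij : (j : ℕ) = i + 1) :
    T (v j) = LinearMap.toMatrix v v T j j • v j + LinearMap.toMatrix v v T i j • v i := by
  rw [← v.sum_repr (T (v j)), Finset.sum_eq_add j i (by intro e; subst e; omega)]
  · simp only [LinearMap.toMatrix_apply]
  · rintro k - ⟨hk, hk'⟩
    by_cases hz : LinearMap.toMatrix v v T k j = 0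
    · rw [← LinearMap.toMatrix_apply v v T k j, hz, zero_smul]
    · rcases h.1 j k hz with h1 | h1
      · exact absurd h1.symm hk
      · exact absurd (Fin.ext (by omega)) hk'
  · simp
  · simp

theorem apply_basis_zero_of_isUpperBidiagonal {F V : Type*} [Field F] [AddCommGroup V]
    [Module F V] {n : ℕ} {v : Module.Basis (Fin n) F V} {T : Module.End F V}
    (h : IsUpperBidiagonal (LinearMap.toMatrix v v T)) {j : Fin n} (hj : (j : ℕ) = 0) :
    T (v j) = LinearMap.toMatrix v v T j j • v j := by
  rw [← v.sum_repr (T (v j)), Finset.sum_eq_single j]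
  · simp only [LinearMap.toMatrix_apply]
  · rintro k - hk
    by_cases hz : LinearMap.toMatrix v v T k j = 0
    · rw [← LinearMap.toMatrix_apply v v T k j, hz, zero_smul]
    · rcases h.1 j k hz with h1 | h1
      · exact absurd h1.symm hk
      · omega
  · simp

theorem apply_basis_of_isLowerBidiagonal {F V : Type*} [Field F] [AddCommGroup V] [Module F V]
    {n : ℕ} {v : Module.Basis (Fin n) F V} {T : Module.End F V}
    (h : IsLowerBidiagonal (LinearMap.toMatrix v v T)) {i j : Fin n}
    (hij : (j : ℕ) = i + 1) :
    T (v i) = LinearMap.toMatrix v v T i i • v i + LinearMap.toMatrix v v T j i • v j := by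
  have h' := apply_basis_of_isUpperBidiagonal h.reindex_revPerm (i := j.rev) (j := i.rev)
    (by simp only [Fin.val_rev]; omega)
  simpa only [toMatrix_reindex_revPerm, Fin.rev_rev, Module.Basis.reindex_apply,
    Fin.revPerm_symm, Fin.revPerm_apply] using h'

/-! ### Simplicity of the spectrum -/

/-- Each row of the eigenvector equation expresses the next coordinate as a multiple of the
current one, so an eigenvector is determined by its first coordinate. -/
theorem eq_zero_of_isUpperBidiagonal_of_repr_zero {F V : Type*} [Field F] [AddCommGroup V]
    [Module F V] {n : ℕ} {v : Module.Basis (Fin n) F V} {T : Module.End F V}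
    (h : IsUpperBidiagonal (LinearMap.toMatrix v v T)) {w : V} {a : F} (hw : T w = a • w)
    (h0 : ∀ i : Fin n, (i : ℕ) = 0 → v.repr w i = 0) : w = 0 := by
  have key : ∀ (m : ℕ) (i : Fin n), (i : ℕ) = m → v.repr w i = 0 := by
    intro m
    induction m with
    | zero => exact h0
    | succ m ih =>
      intro j hj
      have hm : m < n := by omega
      have e := repr_apply_of_isUpperBidiagonal h w (i := ⟨m, hm⟩) (j := j) hj
      rw [hw, map_smul, Finsupp.smul_apply, ih ⟨m, hm⟩ rfl, smul_zero, mul_zero, zero_add] at e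
      exact (mul_eq_zero.1 e.symm).resolve_left (h.2 j ⟨m, hm⟩ hj)
  apply v.repr.injective
  ext i
  simpa using key i i rfl

theorem diag_injective_of_isUpperBidiagonal {F V : Type*} [Field F] [AddCommGroup V]
    [Module F V] {n : ℕ} {e u : Module.Basis (Fin n) F V} {T : Module.End F V}
    (hd : (LinearMap.toMatrix e e T).IsDiag) (hu : IsUpperBidiagonal (LinearMap.toMatrix u u T)) :
    Function.Injective (LinearMap.toMatrix e e T).diag := by
  intro k l hkl
  simp only [Matrix.diag_apply] at hkl
  by_contra hne
  have hn : 0 < n := k.pos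
  -- a combination of the two eigenvectors whose first coordinate cancels
  set w := u.repr (e l) ⟨0, hn⟩ • e k - u.repr (e k) ⟨0, hn⟩ • e l with hw
  have hw0 : w = 0 := by
    refine eq_zero_of_isUpperBidiagonal_of_repr_zero hu
      (a := LinearMap.toMatrix e e T k k) ?_ ?_
    · rw [hw, map_sub, map_smul, map_smul, apply_basis_of_isDiag hd k,
        apply_basis_of_isDiag hd l, ← hkl, smul_sub, smul_comm, smul_comm _ _ (e l)]
    · intro i hi
      have : i = ⟨0, hn⟩ := Fin.ext hi
      subst this
      simp [hw, mul_comm]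
  have hk : u.repr (e k) ⟨0, hn⟩ = 0 := by
    have := congrArg (fun t => e.repr t l) hw0
    simpa [hw, Finsupp.single_apply, hne] using this
  refine e.ne_zero k (eq_zero_of_isUpperBidiagonal_of_repr_zero hu
    (apply_basis_of_isDiag hd k) ?_)
  intro i hi
  rwa [show i = ⟨0, hn⟩ from Fin.ext hi]

/-! ### Pairs of transition equations -/

/-- The coordinates `c k j` of the eigenvectors of one operator in an eigenbasis of another,
when each operator is upper bidiagonal in the eigenbasis of the other one: `A` and `β` are the
eigenvalue sequences, `x` and `y` the diagonals of the two bidiagonal matrices, and `s` and `φ`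
their off-diagonal entries. -/
structure IsBidiagonalTransition {F : Type*} [Field F] {n : ℕ} (c : Fin n → Fin n → F)
    (A x β y : Fin n → F) (s φ : Fin n → Fin n → F) : Prop where
  injA : Function.Injective A
  injβ : Function.Injective β
  ne_zero : ∀ k, ∃ j, c k j ≠ 0
  s_ne_zero : ∀ i j : Fin n, (j : ℕ) = i + 1 → s i j ≠ 0
  φ_ne_zero : ∀ i j : Fin n, (j : ℕ) = i + 1 → φ i j ≠ 0
  row : ∀ k i j : Fin n, (j : ℕ) = i + 1 → (A k - x i) * c k i = s i j * c k j
  row_last : ∀ k i : Fin n, (i : ℕ) + 1 = n → (A k - x i) * c k i = 0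
  col : ∀ k l j : Fin n, (l : ℕ) = k + 1 → (β j - y l) * c l j = φ k l * c k j
  col_zero : ∀ k j : Fin n, (k : ℕ) = 0 → (β j - y k) * c k j = 0

namespace IsBidiagonalTransition

variable {F : Type*} [Field F] {n : ℕ} {c : Fin n → Fin n → F}
    {A x β y : Fin n → F} {s φ : Fin n → Fin n → F}

theorem ne_zero_of_le (h : IsBidiagonalTransition c A x β y s φ) {k j : Fin n}
    (hj : c k j ≠ 0) {i : Fin n} (hi : i ≤ j) : c k i ≠ 0 := by
  have key : ∀ (m : ℕ) (i : Fin n), (i : ℕ) + m = j → c k i ≠ 0 := by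
    intro m
    induction m with
    | zero =>
      intro i hi
      rwa [show i = j from Fin.ext (by omega)]
    | succ m ih =>
      intro i hi hz
      have hlt : (i : ℕ) + 1 < n := by omega
      have e := h.row k i ⟨i + 1, hlt⟩ rfl
      rw [hz, mul_zero] at e
      exact mul_ne_zero (h.s_ne_zero _ _ rfl) (ih ⟨i + 1, hlt⟩ (by simp only; omega)) e.symm
  have hi' : (i : ℕ) ≤ j := hi
  exact key (j - i) i (by omega)

/-- The diagonal entry at the end of an initial-segment support is the eigenvalue. -/
theorem eq_of_support (h : IsBidiagonalTransition c A x β y s φ) {k i : Fin n}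
    (hi : c k i ≠ 0) (hz : ∀ j : Fin n, (j : ℕ) = i + 1 → c k j = 0) : x i = A k := by
  have e : (A k - x i) * c k i = 0 := by
    by_cases hlt : (i : ℕ) + 1 < n
    · rw [h.row k i ⟨i + 1, hlt⟩ rfl, hz _ rfl, mul_zero]
    · exact h.row_last k i (by omega)
  exact (sub_eq_zero.1 ((mul_eq_zero.1 e).resolve_right hi)).symm

/-- The transition matrix is triangular with no zero entry in its triangle. Passing from column
`k` to column `k + 1`, the support can only grow, and by at most one index because the `β` are
distinct; it does grow because the eigenvalue is read off at the end of the support and the `A`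
are distinct. -/
theorem ne_zero_iff (h : IsBidiagonalTransition c A x β y s φ) (k j : Fin n) :
    c k j ≠ 0 ↔ j ≤ k := by
  have key : ∀ (m : ℕ) (k : Fin n), (k : ℕ) = m → ∀ j, c k j ≠ 0 ↔ j ≤ k := by
    intro m
    induction m with
    | zero =>
      intro k hk j
      have hkk : c k k ≠ 0 := by
        obtain ⟨i, hi⟩ := h.ne_zero k
        exact h.ne_zero_of_le hi (Fin.le_def.2 (by omega))
      constructor
      · intro hj
        have e1 := (mul_eq_zero.1 (h.col_zero k j hk)).resolve_right hj
        have e2 := (mul_eq_zero.1 (h.col_zero k k hk)).resolve_right hkk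
        exact (h.injβ ((sub_eq_zero.1 e1).trans (sub_eq_zero.1 e2).symm)).le
      · exact fun hj => h.ne_zero_of_le hkk hj
    | succ m ih =>
      intro l hl
      have hm : m < n := by omega
      set k : Fin n := ⟨m, hm⟩ with hk
      have hlk : (l : ℕ) = k + 1 := hl
      have hck := ih k rfl
      have hclk : c l k ≠ 0 := by
        intro hz
        have e := h.col k l k hlk
        rw [hz, mul_zero] at e
        exact mul_ne_zero (h.φ_ne_zero k l hlk) ((hck k).2 le_rfl) e.symm
      have hgt : ∀ j : Fin n, k < j → c l j ≠ 0 → β j = y l := by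
        intro j hj hlj
        have e := h.col k l j hlk
        rw [not_not.1 (mt (hck j).1 (not_le.2 hj)), mul_zero] at e
        exact sub_eq_zero.1 ((mul_eq_zero.1 e).resolve_right hlj)
      have hkl : k < l := Fin.lt_def.2 (by omega)
      have hll : c l l ≠ 0 := by
        intro hz
        have e1 : x k = A l := h.eq_of_support hclk fun j hj => by
          rwa [show j = l from Fin.ext (by omega)]
        have e2 : x k = A k := h.eq_of_support ((hck k).2 le_rfl) fun j hj =>
          not_not.1 (mt (hck j).1 (not_le.2 (Fin.lt_def.2 (by omega))))
        exact hkl.ne (h.injA (e2.symm.trans e1))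
      intro j
      constructor
      · intro hj
        by_contra hlt
        have hlt' : l < j := not_le.1 hlt
        exact hlt'.ne (h.injβ ((hgt l hkl hll).trans (hgt j (hkl.trans hlt') hj).symm))
      · exact fun hj => h.ne_zero_of_le hll hj
  exact key k k rfl j

theorem x_eq (h : IsBidiagonalTransition c A x β y s φ) : x = A := by
  funext k
  exact h.eq_of_support ((h.ne_zero_iff k k).2 le_rfl) fun j hj =>
    not_not.1 (mt (h.ne_zero_iff k j).1 (not_le.2 (Fin.lt_def.2 (by omega))))

theorem y_eq (h : IsBidiagonalTransition c A x β y s φ) : y = β := by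
  funext l
  have hll := (h.ne_zero_iff l l).2 le_rfl
  have e : (β l - y l) * c l l = 0 := by
    by_cases hl : (l : ℕ) = 0
    · exact h.col_zero l l hl
    · have hlt : (l : ℕ) - 1 < n := by omega
      have hlk : (l : ℕ) = ((⟨l - 1, hlt⟩ : Fin n) : ℕ) + 1 := by simp only; omega
      rw [h.col ⟨l - 1, hlt⟩ l l hlk,
        not_not.1 (mt (h.ne_zero_iff ⟨l - 1, hlt⟩ l).1 (not_le.2 (Fin.lt_def.2 (by omega)))),
        mul_zero]
  exact (sub_eq_zero.1 ((mul_eq_zero.1 e).resolve_right hll)).symm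

/-- The two ways of going around a square of four transition coefficients agree. -/
theorem square (h : IsBidiagonalTransition c A x β y s φ) {j j' k k' : Fin n}
    (hj : (j' : ℕ) = j + 1) (hk : (k' : ℕ) = k + 1) (hjk : j < k') :
    (β j - β k') * (A k - A j) = (A k' - A j) * (β j' - β k') := by
  have hx := h.x_eq
  have hy := h.y_eq
  subst hx hy
  have e1 := h.row k' j j' hj
  have e2 := h.row k j j' hj
  have e3 := h.col k k' j hk
  have e4 := h.col k k' j' hk
  have hne := (h.ne_zero_iff k' j).2 hjk.le
  apply mul_right_cancel₀ hne
  linear_combination (x k - x j) * e3 + φ k k' * e2 - s j j' * e4 - (y j' - y k') * e1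

theorem two_step (h : IsBidiagonalTransition c A x β y s φ) {i j k : Fin n}
    (hij : (j : ℕ) = i + 1) (hjk : (k : ℕ) = j + 1) :
    (β i - β j) * (A i - A j) = (β j - β k) * (A j - A k) := by
  have := h.square hij hjk (Fin.lt_def.2 (by omega))
  linear_combination -this

theorem three_step (h : IsBidiagonalTransition c A x β y s φ) {i j k l : Fin n}
    (hij : (j : ℕ) = i + 1) (hjk : (k : ℕ) = j + 1) (hkl : (l : ℕ) = k + 1) :
    (β i - β j) * (β k - β l) = (β j - β k) ^ 2 := by
  have e1 := h.two_step hij hjk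
  have e2 := h.two_step hjk hkl
  have e3 := h.square hij hkl (Fin.lt_def.2 (by omega))
  have hne : ∀ {a b : Fin n}, (b : ℕ) = a + 1 → β a - β b ≠ 0 := fun hab hz => by
    have := congrArg Fin.val (h.injβ (sub_eq_zero.1 hz))
    omega
  have hA : A i - A j ≠ 0 := fun hz => by
    have := congrArg Fin.val (h.injA (sub_eq_zero.1 hz))
    omega
  apply mul_left_cancel₀ (mul_ne_zero hA (hne hij))
  -- in terms of consecutive differences the square relation is homogeneous, and `e1`, `e2`
  -- say that the products `p * P`, `p' * P'`, `p'' * P''` agree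
  generalize hp : β i - β j = p at *
  generalize hp' : β j - β k = p' at *
  generalize hp'' : β k - β l = p'' at *
  generalize hP : A i - A j = P at *
  generalize hP' : A j - A k = P' at *
  generalize hP'' : A k - A l = P'' at *
  have f1 : β i - β l = p + p' + p'' := by rw [← hp, ← hp', ← hp'']; ring
  have f2 : A k - A i = -(P + P') := by rw [← hP, ← hP']; ring
  have f3 : A l - A i = -(P + P' + P'') := by rw [← hP, ← hP', ← hP'']; ring
  have f4 : β j - β l = p' + p'' := by rw [← hp', ← hp'']; ring
  rw [f1, f2, f3, f4] at e3
  linear_combination -(p' * p'') * (e3 + e1 + e2) - p' ^ 2 * (e1 + e2) + p * p'' * e1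

end IsBidiagonalTransition

theorem IsRecurrent.ratio_unique {F : Type*} [Field F] {n : ℕ} {b b' : F} {α : Fin n → F}
    (hn : 3 ≤ n) (h : IsRecurrent b α) (h' : IsRecurrent b' α) : b = b' := by
  rw [← h.2 ⟨0, by omega⟩ ⟨1, by omega⟩ ⟨2, by omega⟩ rfl rfl,
    ← h'.2 ⟨0, by omega⟩ ⟨1, by omega⟩ ⟨2, by omega⟩ rfl rfl]

/-- With at most two terms there is no ratio, so the parameter is arbitrary. -/
theorem IsRecurrent.of_le_two {F : Type*} [Field F] {n : ℕ} {b : F} {α : Fin n → F}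
    (hn : n ≤ 2) (h : IsRecurrent b α) (b' : F) : IsRecurrent b' α :=
  ⟨h.1, fun i j k hij hjk => by omega⟩

theorem IsBidiagonalTransition.exists_isRecurrent {F : Type*} [Field F] {n : ℕ}
    {c : Fin n → Fin n → F} {A x β y : Fin n → F} {s φ : Fin n → Fin n → F}
    (h : IsBidiagonalTransition c A x β y s φ) :
    ∃ b : F, b ≠ 0 ∧ IsRecurrent b (A ∘ Fin.rev) ∧ IsRecurrent b β := by
  have hneβ : ∀ {i j : Fin n}, (j : ℕ) = i + 1 → β i - β j ≠ 0 := fun hij hz => by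
    have := congrArg Fin.val (h.injβ (sub_eq_zero.1 hz))
    omega
  have hneA : ∀ {i j : Fin n}, (j : ℕ) = i + 1 → A i - A j ≠ 0 := fun hij hz => by
    have := congrArg Fin.val (h.injA (sub_eq_zero.1 hz))
    omega
  have hA1 : ∀ i j : Fin n, (j : ℕ) = i + 1 → (A ∘ Fin.rev) i ≠ (A ∘ Fin.rev) j :=
    fun i j hij e => by
      have := congrArg Fin.val (h.injA e)
      simp only [Fin.val_rev] at this
      omega
  have hβ1 : ∀ i j : Fin n, (j : ℕ) = i + 1 → β i ≠ β j :=
    fun i j hij => sub_ne_zero.1 (hneβ hij)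
  by_cases hn : n ≤ 2
  · exact ⟨1, one_ne_zero, ⟨hA1, fun i j k hij hjk => by omega⟩,
      ⟨hβ1, fun i j k hij hjk => by omega⟩⟩
  push Not at hn
  set b : F := (β ⟨1, by omega⟩ - β ⟨2, by omega⟩) / (β ⟨0, by omega⟩ - β ⟨1, by omega⟩) with hb
  have hβ2 : ∀ (m : ℕ) (i j k : Fin n), (i : ℕ) = m → (j : ℕ) = i + 1 → (k : ℕ) = j + 1 →
      (β j - β k) / (β i - β j) = b := by
    intro m
    induction m with
    | zero =>
      intro i j k hi hj hk
      rw [hb, show i = ⟨0, by omega⟩ from Fin.ext hi,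
        show j = ⟨1, by omega⟩ from Fin.ext (by simp only; omega),
        show k = ⟨2, by omega⟩ from Fin.ext (by simp only; omega)]
    | succ m ih =>
      intro j k l hj hk hl
      have hm : m < n := by omega
      rw [← ih ⟨m, hm⟩ j k rfl hj hk, div_eq_div_iff (hneβ hk) (hneβ (i := ⟨m, hm⟩) hj)]
      have := h.three_step (i := ⟨m, hm⟩) hj hk hl
      linear_combination this
  refine ⟨b, div_ne_zero (hneβ rfl) (hneβ rfl), ⟨hA1, ?_⟩, hβ1, fun i j k => hβ2 i i j k rfl⟩
  intro i j k hij hjk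
  have hk : (j.rev : ℕ) = k.rev + 1 := by simp only [Fin.val_rev]; omega
  have hj : (i.rev : ℕ) = j.rev + 1 := by simp only [Fin.val_rev]; omega
  have e := h.two_step hk hj
  simp only [Function.comp_apply]
  rw [← hβ2 k.rev k.rev j.rev i.rev rfl hk hj,
    div_eq_div_iff (fun hz => hneA hj (by linear_combination -hz)) (hneβ hk)]
  linear_combination -e

theorem isBidiagonalTransition_of_bases {F V : Type*} [Field F] [AddCommGroup V] [Module F V]
    {n : ℕ} {e u : Module.Basis (Fin n) F V} {S T : Module.End F V}
    (hSe : (LinearMap.toMatrix e e S).IsDiag) (hTe : IsUpperBidiagonal (LinearMap.toMatrix e e T))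
    (hSu : IsUpperBidiagonal (LinearMap.toMatrix u u S)) (hTu : (LinearMap.toMatrix u u T).IsDiag) :
    IsBidiagonalTransition (fun k j => u.repr (e k) j)
      (LinearMap.toMatrix e e S).diag (LinearMap.toMatrix u u S).diag
      (LinearMap.toMatrix u u T).diag (LinearMap.toMatrix e e T).diag
      (LinearMap.toMatrix u u S) (LinearMap.toMatrix e e T) where
  injA := diag_injective_of_isUpperBidiagonal hSe hSu
  injβ := diag_injective_of_isUpperBidiagonal hTu hTe
  ne_zero k := by
    by_contra hz
    push Not at hz
    exact e.ne_zero k (u.repr.injective (by ext j; simpa using hz j))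
  s_ne_zero i j hij := hSu.2 j i hij
  φ_ne_zero i j hij := hTe.2 j i hij
  row k i j hij := by
    have h := repr_apply_of_isUpperBidiagonal hSu (e k) hij
    rw [apply_basis_of_isDiag hSe, map_smul, Finsupp.smul_apply, smul_eq_mul] at h
    simp only [Matrix.diag_apply]
    linear_combination h
  row_last k i hi := by
    have h := repr_apply_last_of_isUpperBidiagonal hSu (e k) hi
    rw [apply_basis_of_isDiag hSe, map_smul, Finsupp.smul_apply, smul_eq_mul] at h
    simp only [Matrix.diag_apply]
    linear_combination h
  col k l j hkl := by
    have h := repr_apply_of_isDiag hTu (e l) j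
    rw [apply_basis_of_isUpperBidiagonal hTe hkl, map_add, map_smul, map_smul, Finsupp.add_apply,
      Finsupp.smul_apply, Finsupp.smul_apply, smul_eq_mul, smul_eq_mul] at h
    simp only [Matrix.diag_apply]
    linear_combination -h
  col_zero k j hk := by
    have h := repr_apply_of_isDiag hTu (e k) j
    rw [apply_basis_zero_of_isUpperBidiagonal hTe hk, map_smul,
      Finsupp.smul_apply, smul_eq_mul] at h
    simp only [Matrix.diag_apply]
    linear_combination -h

/-- The consequences for two operators, each of which is diagonal in one basis and bidiagonal in
the other: the diagonals of the bidiagonal matrices are the reversed eigenvalue sequences, and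
both eigenvalue sequences are recurrent with a common parameter. -/
theorem bidiagonal_pair {F V : Type*} [Field F] [AddCommGroup V] [Module F V]
    {n : ℕ} {v u : Module.Basis (Fin n) F V} {S T : Module.End F V}
    (hSv : (LinearMap.toMatrix v v S).IsDiag) (hTv : IsLowerBidiagonal (LinearMap.toMatrix v v T))
    (hSu : IsUpperBidiagonal (LinearMap.toMatrix u u S)) (hTu : (LinearMap.toMatrix u u T).IsDiag) :
    Function.Injective (LinearMap.toMatrix v v S).diag ∧
    (∀ i, LinearMap.toMatrix v v T i i = LinearMap.toMatrix u u T i.rev i.rev) ∧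
    ∃ b : F, b ≠ 0 ∧ IsRecurrent b (LinearMap.toMatrix v v S).diag ∧
      IsRecurrent b (LinearMap.toMatrix u u T).diag := by
  have h := isBidiagonalTransition_of_bases (IsDiag.reindex_revPerm hSv) hTv.reindex_revPerm hSu hTu
  have hS : (LinearMap.toMatrix (v.reindex Fin.revPerm) (v.reindex Fin.revPerm) S).diag ∘ Fin.rev
      = (LinearMap.toMatrix v v S).diag := by
    funext i
    simp [toMatrix_reindex_revPerm]
  refine ⟨?_, fun i => ?_, ?_⟩
  · rw [← hS]
    exact h.injA.comp Fin.rev_injective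
  · have := congrFun h.y_eq i.rev
    simpa [toMatrix_reindex_revPerm] using this
  · obtain ⟨b, hb, h1, h2⟩ := h.exists_isRecurrent
    rw [hS] at h1
    exact ⟨b, hb, h1, h2⟩

/-! ### Closed forms of recurrent sequences and the commutation relations -/

theorem IsRecurrent.exists_geometric {F : Type*} [Field F] {d : ℕ} {b : F} (hb : b ≠ 1)
    {α : Fin (d + 1) → F} (h : IsRecurrent b α) :
    ∃ a a' : F, a' ≠ 0 ∧ ∀ i, α i = a + a' * b ^ (i : ℕ) := by
  have hb' : (1 : F) - b ≠ 0 := sub_ne_zero.2 hb.symm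
  rcases Nat.eq_zero_or_pos d with rfl | hd
  · refine ⟨α 0 - 1, 1, one_ne_zero, fun i => ?_⟩
    rw [show i = 0 from Fin.ext (Nat.lt_one_iff.1 i.isLt)]
    simp
  have h01 : α 0 - α ⟨1, by omega⟩ ≠ 0 := sub_ne_zero.2 (h.1 _ _ rfl)
  have hstep : ∀ (m : ℕ) (i j : Fin (d + 1)), (i : ℕ) = m → (j : ℕ) = i + 1 →
      α i - α j = (α 0 - α ⟨1, by omega⟩) * b ^ m := by
    intro m
    induction m with
    | zero =>
      intro i j hi hj
      rw [show i = 0 from Fin.ext hi, show j = ⟨1, by omega⟩ from Fin.ext (by simp only; omega)]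
      simp
    | succ m ih =>
      intro j k hj hk
      have hm : m < d + 1 := by omega
      have e := h.2 ⟨m, hm⟩ j k hj hk
      rw [div_eq_iff (sub_ne_zero.2 (h.1 _ _ hj)), ih ⟨m, hm⟩ j rfl hj] at e
      rw [e]
      ring
  refine ⟨α 0 - (α 0 - α ⟨1, by omega⟩) / (1 - b), (α 0 - α ⟨1, by omega⟩) / (1 - b),
    div_ne_zero h01 hb', ?_⟩
  have key : ∀ (m : ℕ) (i : Fin (d + 1)), (i : ℕ) = m →
      α i = α 0 - (α 0 - α ⟨1, by omega⟩) / (1 - b) +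
        (α 0 - α ⟨1, by omega⟩) / (1 - b) * b ^ m := by
    intro m
    induction m with
    | zero =>
      intro i hi
      rw [show i = 0 from Fin.ext hi]
      simp
    | succ m ih =>
      intro j hj
      have hm : m < d + 1 := by omega
      have e := hstep m ⟨m, hm⟩ j rfl hj
      rw [ih ⟨m, hm⟩ rfl] at e
      generalize α 0 - α ⟨1, _⟩ = t at e ⊢
      have : t = t / (1 - b) * (1 - b) := by field_simp
      rw [pow_succ]
      linear_combination -e - b ^ m * this
  exact fun i => key i i rfl

theorem IsRecurrent.exists_arithmetic {F : Type*} [Field F] {d : ℕ}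
    {α : Fin (d + 1) → F} (h : IsRecurrent 1 α) :
    ∃ a a' : F, a' ≠ 0 ∧ ∀ i, α i = a + a' * ((i : ℕ) : F) := by
  rcases Nat.eq_zero_or_pos d with rfl | hd
  · refine ⟨α 0, 1, one_ne_zero, fun i => ?_⟩
    rw [show i = 0 from Fin.ext (Nat.lt_one_iff.1 i.isLt)]
    simp
  have h01 : α ⟨1, by omega⟩ - α 0 ≠ 0 := sub_ne_zero.2 (h.1 _ _ rfl).symm
  have hstep : ∀ (m : ℕ) (i j : Fin (d + 1)), (i : ℕ) = m → (j : ℕ) = i + 1 →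
      α j - α i = α ⟨1, by omega⟩ - α 0 := by
    intro m
    induction m with
    | zero =>
      intro i j hi hj
      rw [show i = 0 from Fin.ext hi, show j = ⟨1, by omega⟩ from Fin.ext (by simp only; omega)]
    | succ m ih =>
      intro j k hj hk
      have hm : m < d + 1 := by omega
      have e := h.2 ⟨m, hm⟩ j k hj hk
      rw [div_eq_iff (sub_ne_zero.2 (h.1 _ _ hj))] at e
      rw [← ih ⟨m, hm⟩ j rfl hj]
      linear_combination -e
  refine ⟨α 0, α ⟨1, by omega⟩ - α 0, h01, ?_⟩
  have key : ∀ (m : ℕ) (i : Fin (d + 1)), (i : ℕ) = m →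
      α i = α 0 + (α ⟨1, by omega⟩ - α 0) * (m : F) := by
    intro m
    induction m with
    | zero =>
      intro i hi
      rw [show i = 0 from Fin.ext hi]
      simp
    | succ m ih =>
      intro j hj
      have hm : m < d + 1 := by omega
      have e := hstep m ⟨m, hm⟩ j rfl hj
      rw [ih ⟨m, hm⟩ rfl] at e
      push_cast
      linear_combination e
  exact fun i => key i i rfl

/-- If `S` is diagonal with entries `a + a' b ^ i` and `T` is lower bidiagonal with diagonal
`c + c' b ^ (d - i)`, then the `q`-commutator of `S - a` and `T - c` is a scalar: its subdiagonal
vanishes because `S - a` scales by `b` along it. -/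
theorem qCommutator_eq {F V : Type*} [Field F] [AddCommGroup V] [Module F V] {d : ℕ}
    {v : Module.Basis (Fin (d + 1)) F V} {S T : Module.End F V} {a a' b c c' : F}
    (hS : (LinearMap.toMatrix v v S).IsDiag) (hT : IsLowerBidiagonal (LinearMap.toMatrix v v T))
    (hα : ∀ i, LinearMap.toMatrix v v S i i = a + a' * b ^ (i : ℕ))
    (hδ : ∀ i, LinearMap.toMatrix v v T i i = c + c' * b ^ (i.rev : ℕ)) :
    (S - a • 1) * (T - c • 1) - b • ((T - c • 1) * (S - a • 1)) =
      ((1 - b) * (a' * c' * b ^ d)) • (1 : Module.End F V) := by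
  refine v.ext fun i => ?_
  have hSi := apply_basis_of_isDiag hS i
  have hpow : b ^ (i : ℕ) * b ^ (i.rev : ℕ) = b ^ d := by
    rw [← pow_add]
    congr 1
    simp only [Fin.val_rev]
    omega
  by_cases hi : (i : ℕ) + 1 < d + 1
  · have hTi := apply_basis_of_isLowerBidiagonal hT (i := i) (j := ⟨i + 1, hi⟩) rfl
    have hSj := apply_basis_of_isDiag hS ⟨i + 1, hi⟩
    rw [hδ] at hTi
    rw [hα] at hSi hSj
    simp only [LinearMap.sub_apply, Module.End.mul_apply, LinearMap.smul_apply,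
      Module.End.one_apply, map_sub, map_smul, map_add, hTi, hSi, hSj, ← hpow]
    simp only [pow_succ]
    module
  · have hTi : T (v i) = LinearMap.toMatrix v v T i i • v i := by
      have := apply_basis_zero_of_isUpperBidiagonal hT.reindex_revPerm (j := i.rev)
        (by simp only [Fin.val_rev]; omega)
      simpa only [toMatrix_reindex_revPerm, Fin.rev_rev, Module.Basis.reindex_apply,
        Fin.revPerm_symm, Fin.revPerm_apply] using this
    rw [hδ] at hTi
    rw [hα] at hSi
    simp only [LinearMap.sub_apply, Module.End.mul_apply, LinearMap.smul_apply,
      Module.End.one_apply, map_sub, map_smul, hTi, hSi, ← hpow]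
    module

theorem commutator_eq {F V : Type*} [Field F] [AddCommGroup V] [Module F V] {d : ℕ}
    {v : Module.Basis (Fin (d + 1)) F V} {S T : Module.End F V} {a a' c c' : F}
    (hS : (LinearMap.toMatrix v v S).IsDiag) (hT : IsLowerBidiagonal (LinearMap.toMatrix v v T))
    (hα : ∀ i, LinearMap.toMatrix v v S i i = a + a' * ((i : ℕ) : F))
    (hδ : ∀ i, LinearMap.toMatrix v v T i i = c + c' * ((i.rev : ℕ) : F)) :
    S * T - T * S = a' • (T - c • 1) + c' • (S - a • 1) -
      (a' * c' * d) • (1 : Module.End F V) := by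
  refine v.ext fun i => ?_
  have hSi := apply_basis_of_isDiag hS i
  have hsum : ((i.rev : ℕ) : F) = d - ((i : ℕ) : F) := by
    rw [eq_sub_iff_add_eq, ← Nat.cast_add]
    congr 1
    simp only [Fin.val_rev]
    omega
  by_cases hi : (i : ℕ) + 1 < d + 1
  · have hTi := apply_basis_of_isLowerBidiagonal hT (i := i) (j := ⟨i + 1, hi⟩) rfl
    have hSj := apply_basis_of_isDiag hS ⟨i + 1, hi⟩
    rw [hδ, hsum] at hTi
    rw [hα] at hSi hSj
    simp only [LinearMap.sub_apply, LinearMap.add_apply, Module.End.mul_apply,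
      LinearMap.smul_apply, Module.End.one_apply, map_smul, map_add, hTi, hSi, hSj]
    push_cast
    module
  · have hTi : T (v i) = LinearMap.toMatrix v v T i i • v i := by
      have := apply_basis_zero_of_isUpperBidiagonal hT.reindex_revPerm (j := i.rev)
        (by simp only [Fin.val_rev]; omega)
      simpa only [toMatrix_reindex_revPerm, Fin.rev_rev, Module.Basis.reindex_apply,
        Fin.revPerm_symm, Fin.revPerm_apply] using this
    rw [hδ, hsum] at hTi
    rw [hα] at hSi
    simp only [LinearMap.sub_apply, LinearMap.add_apply, Module.End.mul_apply,
      LinearMap.smul_apply, Module.End.one_apply, map_smul, hTi, hSi]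
    module

/-! ### Irreducibility -/

theorem eq_bot_or_eq_top_of_invariant {F V : Type*} [Field F] [AddCommGroup V] [Module F V]
    {n : ℕ} {v : Module.Basis (Fin n) F V} {X Y Z : Module.End F V}
    (hX : (LinearMap.toMatrix v v X).IsDiag)
    (hinj : Function.Injective (LinearMap.toMatrix v v X).diag)
    (hY : IsLowerBidiagonal (LinearMap.toMatrix v v Y))
    (hZ : IsUpperBidiagonal (LinearMap.toMatrix v v Z)) (W : Submodule F V)
    (hWX : ∀ w ∈ W, X w ∈ W) (hWY : ∀ w ∈ W, Y w ∈ W) (hWZ : ∀ w ∈ W, Z w ∈ W) :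
    W = ⊥ ∨ W = ⊤ := by
  refine or_iff_not_imp_left.2 fun hbot => ?_
  obtain ⟨w, hw, hw0⟩ := W.ne_bot_iff.1 hbot
  obtain ⟨i, hi⟩ : ∃ i, v.repr w i ≠ 0 := by
    by_contra hz
    push Not at hz
    exact hw0 (v.repr.injective (by ext j; simpa using hz j))
  -- the Lagrange polynomial at the `i`-th eigenvalue projects `w` onto the line of `v i`
  have hvi : v i ∈ W := by
    set p := Lagrange.basis Finset.univ (LinearMap.toMatrix v v X).diag i with hp
    have hpow : ∀ (r : Polynomial F) (u : V), u ∈ W → Polynomial.aeval X r u ∈ W := by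
      intro r u hu
      induction r using Polynomial.induction_on' with
      | add r s hr hs =>
        rw [map_add]
        exact W.add_mem hr hs
      | monomial m a =>
        rw [Polynomial.aeval_monomial, Module.End.mul_apply, Module.algebraMap_end_apply]
        refine W.smul_mem a ?_
        induction m with
        | zero => simpa using hu
        | succ m ih =>
          rw [pow_succ', Module.End.mul_apply]
          exact hWX _ ih
    have hpv : ∀ j, Polynomial.aeval X p (v j) =
        p.eval ((LinearMap.toMatrix v v X).diag j) • v j := fun j =>
      Module.End.aeval_apply_of_hasEigenvector
        ⟨Module.End.mem_eigenspace_iff.2 (apply_basis_of_isDiag hX j), v.ne_zero j⟩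
    have hpw : Polynomial.aeval X p w = v.repr w i • v i := by
      conv_lhs => rw [← v.sum_repr w]
      rw [map_sum, Finset.sum_eq_single i]
      · rw [map_smul, hpv, hp, Lagrange.eval_basis_self hinj.injOn (Finset.mem_univ i), one_smul]
      · intro j _ hj
        rw [map_smul, hpv, hp, Lagrange.eval_basis_of_ne hj.symm (Finset.mem_univ j), zero_smul,
          smul_zero]
      · simp
    have := hpow p w hw
    rw [hpw] at this
    exact (W.smul_mem_iff hi).1 this
  have hup : ∀ (m : ℕ) (j : Fin n), (j : ℕ) = i + m → v j ∈ W := by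
    intro m
    induction m with
    | zero =>
      intro j hj
      rwa [show j = i from Fin.ext hj]
    | succ m ih =>
      intro k hk
      have hlt : (i : ℕ) + m < n := by omega
      have hj := ih ⟨i + m, hlt⟩ rfl
      have hjk : (k : ℕ) = ((⟨i + m, hlt⟩ : Fin n) : ℕ) + 1 := by simp only; omega
      have e := hWY _ hj
      rw [apply_basis_of_isLowerBidiagonal hY hjk] at e
      exact (W.smul_mem_iff (hY.2 _ _ hjk)).1 ((W.add_mem_iff_right (W.smul_mem _ hj)).1 e)
  have hdown : ∀ (m : ℕ) (j : Fin n), (j : ℕ) + m = i → v j ∈ W := by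
    intro m
    induction m with
    | zero =>
      intro j hj
      rwa [show j = i from Fin.ext hj]
    | succ m ih =>
      intro k hk
      have hlt : (k : ℕ) + 1 < n := by omega
      have hj := ih ⟨k + 1, hlt⟩ (by simp only; omega)
      have e := hWZ _ hj
      rw [apply_basis_of_isUpperBidiagonal hZ (i := k) rfl] at e
      exact (W.smul_mem_iff (hZ.2 ⟨k + 1, hlt⟩ k rfl)).1
        ((W.add_mem_iff_right (W.smul_mem _ hj)).1 e)
  rw [eq_top_iff, ← v.span_eq, Submodule.span_le]
  rintro _ ⟨j, rfl⟩
  rcases le_total (i : ℕ) j with hij | hij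
  · exact hup (j - i) j (by omega)
  · exact hdown (i - j) j (by omega)

/-! ### Module structures from operators -/

/-- Operators satisfying the equitable relations make `V` a module over `U_q(sl₂)`, which is
simple when no proper nonzero subspace is invariant under `x`, `y` and `z`. -/
theorem exists_simple_Uqsl2_module {F V : Type*} [Field F] [AddCommGroup V] [Module F V]
    [Nontrivial V] (q : F) (x y y' z : Module.End F V) (hyy' : y * y' = 1) (hy'y : y' * y = 1)
    (hxy : (q - q⁻¹)⁻¹ • (q • (x * y) - q⁻¹ • (y * x)) = 1)
    (hyz : (q - q⁻¹)⁻¹ • (q • (y * z) - q⁻¹ • (z * y)) = 1)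
    (hzx : (q - q⁻¹)⁻¹ • (q • (z * x) - q⁻¹ • (x * z)) = 1)
    (hirr : ∀ W : Submodule F V, (∀ w ∈ W, x w ∈ W) → (∀ w ∈ W, y w ∈ W) →
      (∀ w ∈ W, z w ∈ W) → W = ⊥ ∨ W = ⊤) :
    ∃ (_ : Module (Uqsl2 F q) V) (_ : IsScalarTower F (Uqsl2 F q) V),
      IsSimpleModule (Uqsl2 F q) V ∧
      Uqsl2.action V (Uqsl2.gen F q EquitableGen.x) = x ∧
      Uqsl2.action V (Uqsl2.gen F q EquitableGen.y) = y ∧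
      Uqsl2.action V (Uqsl2.gen F q EquitableGen.z) = z := by
  let g : EquitableGen → Module.End F V := fun t => match t with
    | .x => x
    | .y => y
    | .yInv => y'
    | .z => z
  have hrel : ∀ ⦃a b : FreeAlgebra F EquitableGen⦄, EquitableRel F q a b →
      FreeAlgebra.lift F g a = FreeAlgebra.lift F g b := by
    intro a b hab
    cases hab with
    | y_mul_yInv => simpa [g] using hyy'
    | yInv_mul_y => simpa [g] using hy'y
    | xy => simpa only [map_smul, map_sub, map_mul, map_one, FreeAlgebra.lift_ι_apply] using hxy
    | yz => simpa only [map_smul, map_sub, map_mul, map_one, FreeAlgebra.lift_ι_apply] using hyz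
    | zx => simpa only [map_smul, map_sub, map_mul, map_one, FreeAlgebra.lift_ι_apply] using hzx
  let ρ : Uqsl2 F q →ₐ[F] Module.End F V :=
    RingQuot.liftAlgHom F ⟨FreeAlgebra.lift F g, hrel⟩
  have hρ : ∀ t, ρ (Uqsl2.gen F q t) = g t := fun t => by
    refine (RingQuot.liftAlgHom_mkAlgHom_apply F (FreeAlgebra.lift F g) hrel _).trans ?_
    exact FreeAlgebra.lift_ι_apply _ _
  let M : Module (Uqsl2 F q) V := Module.compHom V ρ.toRingHom
  have hsmul : ∀ (u : Uqsl2 F q) (w : V), u • w = ρ u w := fun _ _ => rfl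
  have T : IsScalarTower F (Uqsl2 F q) V := ⟨fun a u w => by
    rw [hsmul, hsmul, map_smul, LinearMap.smul_apply]⟩
  have hact : ∀ t, Uqsl2.action V (Uqsl2.gen F q t) = g t := fun t => by
    rw [← hρ]
    rfl
  refine ⟨M, T, ?_, hact .x, hact .y, hact .z⟩
  have hS : ∀ N : Submodule (Uqsl2 F q) V, N = ⊥ ∨ N = ⊤ := fun N => by
    have hg : ∀ (t : EquitableGen), ∀ w ∈ N.restrictScalars F, g t w ∈ N.restrictScalars F :=
      fun t w hw => by
        rw [← hρ t, ← hsmul]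
        exact N.smul_mem _ hw
    rcases hirr (N.restrictScalars F) (hg .x) (hg .y) (hg .z) with h | h
    · exact .inl ((Submodule.restrictScalars_eq_bot_iff F _ V).1 h)
    · exact .inr ((Submodule.restrictScalars_eq_top_iff F _ V).1 h)
  exact { eq_bot_or_eq_top := hS }

/-- Operators satisfying the equitable relations make `V` a module over `sl₂`, which is
irreducible when no proper nonzero subspace is invariant under `x`, `y` and `z`. -/
theorem exists_irreducible_sl2_module {F V : Type*} [Field F] [CharZero F] [AddCommGroup V]
    [Module F V] [Nontrivial V] (x y z : Module.End F V)
    (hxy : x * y - y * x = (2 : F) • x + (2 : F) • y)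
    (hyz : y * z - z * y = (2 : F) • y + (2 : F) • z)
    (hzx : z * x - x * z = (2 : F) • z + (2 : F) • x)
    (hirr : ∀ W : Submodule F V, (∀ w ∈ W, x w ∈ W) → (∀ w ∈ W, y w ∈ W) →
      (∀ w ∈ W, z w ∈ W) → W = ⊥ ∨ W = ⊤) :
    ∃ (_ : LieRingModule (LieAlgebra.SpecialLinear.sl (Fin 2) F) V)
      (_ : LieModule F (LieAlgebra.SpecialLinear.sl (Fin 2) F) V),
      LieModule.IsIrreducible F (LieAlgebra.SpecialLinear.sl (Fin 2) F) V ∧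
      LieModule.toEnd F (LieAlgebra.SpecialLinear.sl (Fin 2) F) V (sl2X F) = x ∧
      LieModule.toEnd F (LieAlgebra.SpecialLinear.sl (Fin 2) F) V (sl2Y F) = y ∧
      LieModule.toEnd F (LieAlgebra.SpecialLinear.sl (Fin 2) F) V (sl2Z F) = z := by
  -- `h = z`, `e = (x + z) / 2` and `f = -(y + z) / 2`
  let ρ : LieAlgebra.SpecialLinear.sl (Fin 2) F →ₗ[F] Module.End F V :=
    { toFun := fun A => A.1 0 0 • z + (A.1 0 1 / 2) • (x + z) - (A.1 1 0 / 2) • (y + z)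
      map_add' := fun A B => by
        have hAB : (A + B).1 = A.1 + B.1 := rfl
        simp only [hAB, Matrix.add_apply]
        module
      map_smul' := fun t A => by
        have hA : (t • A).1 = t • A.1 := rfl
        simp only [hA, Matrix.smul_apply, smul_eq_mul, RingHom.id_apply]
        module }
  have hlie : ∀ A B, ρ ⁅A, B⁆ = ρ A * ρ B - ρ B * ρ A := by
    intro A B
    have hA : A.1 1 1 = -A.1 0 0 := by
      have := LinearMap.mem_ker.1 A.2
      simp only [Matrix.traceLinearMap_apply, Matrix.trace_fin_two] at this
      linear_combination this
    have hB : B.1 1 1 = -B.1 0 0 := by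
      have := LinearMap.mem_ker.1 B.2
      simp only [Matrix.traceLinearMap_apply, Matrix.trace_fin_two] at this
      linear_combination this
    have hxy' : x * y = y * x + ((2 : F) • x + (2 : F) • y) := by rw [← hxy]; abel
    have hyz' : y * z = z * y + ((2 : F) • y + (2 : F) • z) := by rw [← hyz]; abel
    have hzx' : z * x = x * z + ((2 : F) • z + (2 : F) • x) := by rw [← hzx]; abel
    have hAB : (⁅A, B⁆ : LieAlgebra.SpecialLinear.sl (Fin 2) F).1 = A.1 * B.1 - B.1 * A.1 := rfl
    simp only [ρ, LinearMap.coe_mk, AddHom.coe_mk, hAB, Matrix.sub_apply, Matrix.mul_apply,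
      Fin.sum_univ_two, hA, hB, mul_add, add_mul, mul_sub, sub_mul, smul_mul_assoc,
      mul_smul_comm, hxy', hyz', hzx', smul_add]
    match_scalars <;> field_simp <;> ring
  let M1 : LieRingModule (LieAlgebra.SpecialLinear.sl (Fin 2) F) V :=
    { bracket := fun A w => ρ A w
      add_lie := fun A B w => by
        change ρ (A + B) w = ρ A w + ρ B w
        rw [map_add, LinearMap.add_apply]
      lie_add := fun A w w' => map_add (ρ A) w w'
      leibniz_lie := fun A B w => by
        change ρ A (ρ B w) = ρ ⁅A, B⁆ w + ρ B (ρ A w)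
        rw [hlie, LinearMap.sub_apply, Module.End.mul_apply, Module.End.mul_apply,
          sub_add_cancel] }
  have M2 : LieModule F (LieAlgebra.SpecialLinear.sl (Fin 2) F) V :=
    { smul_lie := fun t A w => by
        change ρ (t • A) w = t • ρ A w
        rw [map_smul, LinearMap.smul_apply]
      lie_smul := fun t A w => map_smul (ρ A) t w }
  have hact : ∀ A, LieModule.toEnd F (LieAlgebra.SpecialLinear.sl (Fin 2) F) V A = ρ A :=
    fun A => rfl
  have hx : ρ (sl2X F) = x := by
    change (-1 : F) • z + ((2 : F) / 2) • (x + z) - ((0 : F) / 2) • (y + z) = x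
    match_scalars <;> norm_num
  have hy : ρ (sl2Y F) = y := by
    change (-1 : F) • z + ((0 : F) / 2) • (x + z) - ((-2 : F) / 2) • (y + z) = y
    match_scalars <;> norm_num
  have hz : ρ (sl2Z F) = z := by
    change (1 : F) • z + ((0 : F) / 2) • (x + z) - ((0 : F) / 2) • (y + z) = z
    match_scalars <;> norm_num
  refine ⟨M1, M2, ?_, (hact _).trans hx, (hact _).trans hy, (hact _).trans hz⟩
  have hS : ∀ N : LieSubmodule F (LieAlgebra.SpecialLinear.sl (Fin 2) F) V, N = ⊥ ∨ N = ⊤ := by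
    intro N
    have hN : ∀ A, ∀ w ∈ N.toSubmodule, ρ A w ∈ N.toSubmodule := fun A w hw => N.lie_mem hw
    have hNx := hN (sl2X F)
    have hNy := hN (sl2Y F)
    have hNz := hN (sl2Z F)
    rw [hx] at hNx
    rw [hy] at hNy
    rw [hz] at hNz
    rcases hirr N.toSubmodule hNx hNy hNz with h | h
    · exact .inl ((LieSubmodule.toSubmodule_eq_bot N).1 h)
    · exact .inr ((LieSubmodule.toSubmodule_eq_top N).1 h)
  exact { eq_bot_or_eq_top := hS }

/-! ### Normalized operators -/

theorem smul_sub_mem_span {F V : Type*} [Field F] [AddCommGroup V] [Module F V]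
    (T : Module.End F V) (s r : F) : s • T - r • 1 ∈ Submodule.span F {T, 1} :=
  Submodule.sub_mem _ (Submodule.smul_mem _ _ (Submodule.subset_span (by simp)))
    (Submodule.smul_mem _ _ (Submodule.subset_span (by simp)))

theorem mem_of_smul_sub_mem {F V : Type*} [Field F] [AddCommGroup V] [Module F V]
    {T : Module.End F V} {s r : F} (hs : s ≠ 0) {W : Submodule F V}
    (h : ∀ w ∈ W, (s • T - r • (1 : Module.End F V)) w ∈ W) : ∀ w ∈ W, T w ∈ W := by
  intro w hw
  have := h w hw
  rw [LinearMap.sub_apply, LinearMap.smul_apply, LinearMap.smul_apply, Module.End.one_apply,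
    W.sub_mem_iff_left (W.smul_mem _ hw)] at this
  exact (W.smul_mem_iff hs).1 this

/-- Scaling so that the eigenvalue coefficient `a'` becomes `q ^ d` gives the eigenvalues
`q ^ (d - 2 i)` and turns the scalar of `qCommutator_eq` into the one required by the
equitable relation. -/
theorem equitable_qRelation {F V : Type*} [Field F] [AddCommGroup V] [Module F V] {d : ℕ}
    {v : Module.Basis (Fin (d + 1)) F V} {S T : Module.End F V} {a a' q c c' : F}
    (hq : q ≠ 0) (hq2 : q ^ (-2 : ℤ) ≠ 1) (ha : a' ≠ 0) (hc : c' ≠ 0)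
    (hS : (LinearMap.toMatrix v v S).IsDiag) (hT : IsLowerBidiagonal (LinearMap.toMatrix v v T))
    (hα : ∀ i, LinearMap.toMatrix v v S i i = a + a' * (q ^ (-2 : ℤ)) ^ (i : ℕ))
    (hδ : ∀ i, LinearMap.toMatrix v v T i i = c + c' * (q ^ (-2 : ℤ)) ^ (i.rev : ℕ)) :
    (q - q⁻¹)⁻¹ • (q • (((q ^ d / a') • S - (q ^ d / a' * a) • 1) *
        ((q ^ d / c') • T - (q ^ d / c' * c) • 1)) -
      q⁻¹ • (((q ^ d / c') • T - (q ^ d / c' * c) • 1) *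
        ((q ^ d / a') • S - (q ^ d / a' * a) • 1))) = (1 : Module.End F V) := by
  have h := qCommutator_eq hS hT hα hδ
  have hb : q ^ (-2 : ℤ) = q⁻¹ * q⁻¹ := by
    rw [zpow_neg, ← mul_inv]
    norm_cast
    rw [sq]
  rw [hb] at h hq2
  have hqq : q - q⁻¹ ≠ 0 := fun e => hq2 (by
    nth_rewrite 1 [← sub_eq_zero.1 e]
    exact mul_inv_cancel₀ hq)
  have e1 : ∀ (R : Module.End F V) (s r : F), s • R - (s * r) • (1 : Module.End F V) =
      s • (R - r • 1) := fun R s r => by module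
  rw [e1, e1, smul_mul_smul_comm, smul_mul_smul_comm]
  generalize (S - a • 1) * (T - c • 1) = P at h ⊢
  generalize (T - c • 1) * (S - a • 1) = Q at h ⊢
  rw [sub_eq_iff_eq_add] at h
  rw [h, smul_add, smul_add]
  have hd : (q⁻¹ * q⁻¹) ^ d * (q ^ d * q ^ d) = 1 := by
    rw [← mul_pow, ← mul_pow]
    field_simp
    simp
  have h2 : (q - q⁻¹)⁻¹ * (q - q⁻¹) = 1 := inv_mul_cancel₀ hqq
  have h3 : q * q⁻¹ = 1 := mul_inv_cancel₀ hq
  have h4 : a' * a'⁻¹ = 1 := mul_inv_cancel₀ ha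
  have h5 : c' * c'⁻¹ = 1 := mul_inv_cancel₀ hc
  generalize (q⁻¹ * q⁻¹) ^ d = t at *
  generalize q ^ d = u at *
  generalize (q - q⁻¹)⁻¹ = m at *
  simp only [div_eq_mul_inv]
  generalize q⁻¹ = p at *
  generalize a'⁻¹ = ai at *
  generalize c'⁻¹ = ci at *
  match_scalars
  · linear_combination m * (q - q * p * p) * (a' * ai) * (c' * ci) * hd +
      m * (q - q * p * p) * (c' * ci) * h4 + m * (q - q * p * p) * h5 + h2 - m * p * h3
  · linear_combination m * u * u * ai * ci * p * h3

/-- The shift and scaling are chosen so that `S` gets the eigenvalues `2 i - d`. -/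
theorem equitable_relation {F V : Type*} [Field F] [AddCommGroup V] [Module F V] {d : ℕ}
    {v : Module.Basis (Fin (d + 1)) F V} {S T : Module.End F V} {a a' c c' : F}
    (ha : a' ≠ 0) (hc : c' ≠ 0)
    (hS : (LinearMap.toMatrix v v S).IsDiag) (hT : IsLowerBidiagonal (LinearMap.toMatrix v v T))
    (hα : ∀ i, LinearMap.toMatrix v v S i i = a + a' * ((i : ℕ) : F))
    (hδ : ∀ i, LinearMap.toMatrix v v T i i = c + c' * ((i.rev : ℕ) : F)) :
    ((2 / a') • S - (2 / a' * a + d) • 1) * ((2 / c') • T - (2 / c' * c + d) • 1) -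
      ((2 / c') • T - (2 / c' * c + d) • 1) * ((2 / a') • S - (2 / a' * a + d) • 1) =
    (2 : F) • ((2 / a') • S - (2 / a' * a + d) • (1 : Module.End F V)) +
      (2 : F) • ((2 / c') • T - (2 / c' * c + d) • 1) := by
  have h := commutator_eq hS hT hα hδ
  rw [sub_eq_iff_eq_add] at h
  simp only [mul_sub, sub_mul, smul_mul_assoc, mul_smul_comm, mul_one, one_mul, h]
  match_scalars <;> field_simp <;> ring

theorem exists_inverse_of_isDiag {F V : Type*} [Field F] [AddCommGroup V] [Module F V] {n : ℕ}
    {v : Module.Basis (Fin n) F V} {T : Module.End F V}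
    (h : (LinearMap.toMatrix v v T).IsDiag) {s r : F}
    (h0 : ∀ i, s * LinearMap.toMatrix v v T i i - r ≠ 0) :
    ∃ T' : Module.End F V, (s • T - r • 1) * T' = 1 ∧ T' * (s • T - r • 1) = 1 := by
  have hv : ∀ i, (s • T - r • (1 : Module.End F V)) (v i) =
      (s * LinearMap.toMatrix v v T i i - r) • v i := fun i => by
    rw [LinearMap.sub_apply, LinearMap.smul_apply, LinearMap.smul_apply, Module.End.one_apply,
      apply_basis_of_isDiag h]
    module
  refine ⟨v.constr F fun i => (s * LinearMap.toMatrix v v T i i - r)⁻¹ • v i,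
    v.ext fun i => ?_, v.ext fun i => ?_⟩
  · rw [Module.End.mul_apply, v.constr_basis, map_smul, hv, smul_smul, inv_mul_cancel₀ (h0 i),
      one_smul, Module.End.one_apply]
  · rw [Module.End.mul_apply, hv, map_smul, v.constr_basis, smul_smul, mul_inv_cancel₀ (h0 i),
      one_smul, Module.End.one_apply]

theorem mainTheorem12 {F : Type*} [Field F] [IsAlgClosed F] [CharZero F]
    {V : Type*} [AddCommGroup V] [Module F V] (d : ℕ)
    (X Y Z : Module.End F V)
    (v₁ v₂ v₃ : Module.Basis (Fin (d + 1)) F V)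
    (hX₁ : (LinearMap.toMatrix v₁ v₁ X).IsDiag)
    (hY₁ : IsLowerBidiagonal (LinearMap.toMatrix v₁ v₁ Y))
    (hZ₁ : IsUpperBidiagonal (LinearMap.toMatrix v₁ v₁ Z))
    (hX₂ : IsUpperBidiagonal (LinearMap.toMatrix v₂ v₂ X))
    (hY₂ : (LinearMap.toMatrix v₂ v₂ Y).IsDiag)
    (hZ₂ : IsLowerBidiagonal (LinearMap.toMatrix v₂ v₂ Z))
    (hX₃ : IsLowerBidiagonal (LinearMap.toMatrix v₃ v₃ X))
    (hY₃ : IsUpperBidiagonal (LinearMap.toMatrix v₃ v₃ Y))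
    (hZ₃ : (LinearMap.toMatrix v₃ v₃ Z).IsDiag) :
    (∃ b : F, b ≠ 0 ∧
      IsRecurrent b (LinearMap.toMatrix v₁ v₁ X).diag ∧
      IsRecurrent b (LinearMap.toMatrix v₂ v₂ Y).diag ∧
      IsRecurrent b (LinearMap.toMatrix v₃ v₃ Z).diag) ∧
    ∀ b : F, b ≠ 0 →
      IsRecurrent b (LinearMap.toMatrix v₁ v₁ X).diag →
      IsRecurrent b (LinearMap.toMatrix v₂ v₂ Y).diag →
      IsRecurrent b (LinearMap.toMatrix v₃ v₃ Z).diag →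
      (b ≠ 1 → ∀ q : F, b = q ^ (-2 : ℤ) →
        ∃ (_ : Module (Uqsl2 F q) V) (_ : IsScalarTower F (Uqsl2 F q) V),
          IsSimpleModule (Uqsl2 F q) V ∧
          Uqsl2.action V (Uqsl2.gen F q EquitableGen.x) ∈ Submodule.span F {X, 1} ∧
          Uqsl2.action V (Uqsl2.gen F q EquitableGen.y) ∈ Submodule.span F {Y, 1} ∧
          Uqsl2.action V (Uqsl2.gen F q EquitableGen.z) ∈ Submodule.span F {Z, 1}) ∧
      (b = 1 →
        ∃ (_ : LieRingModule (LieAlgebra.SpecialLinear.sl (Fin 2) F) V)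
          (_ : LieModule F (LieAlgebra.SpecialLinear.sl (Fin 2) F) V),
          LieModule.IsIrreducible F (LieAlgebra.SpecialLinear.sl (Fin 2) F) V ∧
          LieModule.toEnd F (LieAlgebra.SpecialLinear.sl (Fin 2) F) V (sl2X F) ∈
            Submodule.span F {X, 1} ∧
          LieModule.toEnd F (LieAlgebra.SpecialLinear.sl (Fin 2) F) V (sl2Y F) ∈
            Submodule.span F {Y, 1} ∧
          LieModule.toEnd F (LieAlgebra.SpecialLinear.sl (Fin 2) F) V (sl2Z F) ∈
            Submodule.span F {Z, 1}) := by
  have : Nontrivial V := ⟨v₁ 0, 0, v₁.ne_zero 0⟩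
  obtain ⟨hinj, hY, b, hb, hbX, hbY⟩ := bidiagonal_pair hX₁ hY₁ hX₂ hY₂
  obtain ⟨-, hZ, b', -, hbY', hbZ⟩ := bidiagonal_pair hY₂ hZ₂ hY₃ hZ₃
  obtain ⟨-, hX, -⟩ := bidiagonal_pair hZ₃ hX₃ hZ₁ hX₁
  have hirr := eq_bot_or_eq_top_of_invariant hX₁ hinj hY₁ hZ₁
  refine ⟨⟨b, hb, hbX, hbY, ?_⟩, ?_⟩
  · -- the middle sequence links the parameters of the two pairs
    rcases le_or_gt (d + 1) 2 with hd | hd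
    · exact hbZ.of_le_two hd b
    · rwa [hbY.ratio_unique hd hbY']
  clear! b b'
  intro b hb hbX hbY hbZ
  constructor
  · rintro hb1 q rfl
    have hq : q ≠ 0 := by
      rintro rfl
      exact hb (by simp)
    obtain ⟨a, a', ha, hα⟩ := hbX.exists_geometric hb1
    obtain ⟨c, c', hc, hβ⟩ := hbY.exists_geometric hb1
    obtain ⟨e, e', he, hγ⟩ := hbZ.exists_geometric hb1
    simp only [Matrix.diag_apply] at hα hβ hγ
    have hne : ∀ {t : F}, t ≠ 0 → q ^ d / t ≠ 0 := fun ht => div_ne_zero (pow_ne_zero d hq) ht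
    obtain ⟨y', hyy', hy'y⟩ := exists_inverse_of_isDiag hY₂ (s := q ^ d / c')
      (r := q ^ d / c' * c) (fun i => by
        rw [hβ, mul_add, add_sub_cancel_left]
        exact mul_ne_zero (hne hc) (mul_ne_zero hc (pow_ne_zero _ hb)))
    obtain ⟨M, T, hsimple, hx, hy, hz⟩ := exists_simple_Uqsl2_module q
      ((q ^ d / a') • X - (q ^ d / a' * a) • 1) ((q ^ d / c') • Y - (q ^ d / c' * c) • 1) y'
      ((q ^ d / e') • Z - (q ^ d / e' * e) • 1) hyy' hy'y
      (equitable_qRelation hq hb1 ha hc hX₁ hY₁ hα fun i => by rw [hY, hβ])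
      (equitable_qRelation hq hb1 hc he hY₂ hZ₂ hβ fun i => by rw [hZ, hγ])
      (equitable_qRelation hq hb1 he ha hZ₃ hX₃ hγ fun i => by rw [hX, hα])
      (fun W hWx hWy hWz => hirr W (mem_of_smul_sub_mem (hne ha) hWx)
        (mem_of_smul_sub_mem (hne hc) hWy) (mem_of_smul_sub_mem (hne he) hWz))
    refine ⟨M, T, hsimple, ?_, ?_, ?_⟩
    · rw [hx]
      exact smul_sub_mem_span X _ _
    · rw [hy]
      exact smul_sub_mem_span Y _ _
    · rw [hz]
      exact smul_sub_mem_span Z _ _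
  · rintro rfl
    obtain ⟨a, a', ha, hα⟩ := hbX.exists_arithmetic
    obtain ⟨c, c', hc, hβ⟩ := hbY.exists_arithmetic
    obtain ⟨e, e', he, hγ⟩ := hbZ.exists_arithmetic
    simp only [Matrix.diag_apply] at hα hβ hγ
    have hne : ∀ {t : F}, t ≠ 0 → 2 / t ≠ 0 := fun ht => div_ne_zero two_ne_zero ht
    obtain ⟨M, T, hsimple, hx, hy, hz⟩ := exists_irreducible_sl2_module
      ((2 / a') • X - (2 / a' * a + d) • 1) ((2 / c') • Y - (2 / c' * c + d) • 1)
      ((2 / e') • Z - (2 / e' * e + d) • 1)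
      (equitable_relation ha hc hX₁ hY₁ hα fun i => by rw [hY, hβ])
      (equitable_relation hc he hY₂ hZ₂ hβ fun i => by rw [hZ, hγ])
      (equitable_relation he ha hZ₃ hX₃ hγ fun i => by rw [hX, hα])
      (fun W hWx hWy hWz => hirr W (mem_of_smul_sub_mem (hne ha) hWx)
        (mem_of_smul_sub_mem (hne hc) hWy) (mem_of_smul_sub_mem (hne he) hWz))
    refine ⟨M, T, hsimple, ?_, ?_, ?_⟩
    · rw [hx]
      exact smul_sub_mem_span X _ _
    · rw [hy]
      exact smul_sub_mem_span Y _ _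
    · rw [hz]
      exact smul_sub_mem_span Z _ _
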